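/- Let formulas be built from a countably infinite set of variables with the connectives $\wedge,\vee,\rightarrow,\neg$ and a unary modality $\square$. Let $p,q,r$ be distinct variables and let $\mathbf{E}$ be the set of formulas derivable by modus ponens and uniform substitution from the axioms of intuitionistic propositional calculus \[ \begin{array}{l} p\rightarrow(q\rightarrow p),\quad (p\rightarrow(q\rightarrow r))\rightarrow((p\rightarrow q)\rightarrow(p\rightarrow r)),\\ (p\wedge q)\rightarrow p,\quad (p\wedge q)\rightarrow q,\quad p\rightarrow(q\rightarrow(p\wedge q)),\\ p\rightarrow(p\vee q),\quad p\rightarrow(q\vee p),\quad (p\rightarrow r)\rightarrow((q\rightarrow r)\rightarrow((p\vee q)\rightarrow r)),\\ (p\rightarrow q)\rightarrow((p\rightarrow\neg q)\rightarrow\neg p),\quad p\rightarrow(\neg p\rightarrow q) \end{array} \] together with the modal axioms \[ \square(p\rightarrow q)\rightarrow(\square p\rightarrow\square q),\quad p\rightarrow\square p,\quad \square p\rightarrow(((q\rightarrow p)\rightarrow q)\rightarrow q). \] A normal extension of $\mathbf{E}$ is a set of formulas that includes $\mathbf{E}$ and is closed under modus ponens, uniform substitution and necessitation $\alpha/\square\alpha$.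 A set $L$ of formulas is closed under the weakening rule $\square\alpha/\alpha$ if, for every formula $\alpha$, $\square\alpha\in L$ implies $\alpha\in L$. Then there is a continuum of normal extensions of $\mathbf{E}$ that are closed under the weakening rule; that is, the set of all such extensions has cardinality $2^{\aleph_0}$. -/

import Mathlib

namespace ModalHeyting

/-- Formulas of the modal language over the variables `var 0, var 1, …`, with the primitive
connectives conjunction, disjunction, implication, negation and the unary modality `box`. -/
inductive Formula : Type
  | var : ℕ → Formula
  | and : Formula → Formula → Formula
  | or : Formula → Formula → Formula
  | imp : Formula → Formula → Formula
  | neg : Formula → Formula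
  | box : Formula → Formula

infixr:60 " ⟶ₘ " => Formula.imp
infixl:70 " ⋏ₘ " => Formula.and
infixl:65 " ⋎ₘ " => Formula.or
prefix:80 "∼ₘ" => Formula.neg
prefix:80 "□ₘ" => Formula.box

/-- Uniform substitution: the endomorphism of the formula algebra that extends `s`. -/
def Formula.subst (s : ℕ → Formula) : Formula → Formula
  | .var n => s n
  | .and α β => (α.subst s) ⋏ₘ (β.subst s)
  | .or α β => (α.subst s) ⋎ₘ (β.subst s)
  | .imp α β => (α.subst s) ⟶ₘ (β.subst s)
  | .neg α => ∼ₘ (α.subst s)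
  | .box α => □ₘ (α.subst s)

/-- The three fixed distinct variables in which the axioms are written. -/
def p : Formula := .var 0

def q : Formula := .var 1

def r : Formula := .var 2

/-- The axioms of intuitionistic propositional calculus. -/
def intAxioms : Set Formula :=
  { p ⟶ₘ (q ⟶ₘ p),
    (p ⟶ₘ (q ⟶ₘ r)) ⟶ₘ ((p ⟶ₘ q) ⟶ₘ (p ⟶ₘ r)),
    (p ⋏ₘ q) ⟶ₘ p,
    (p ⋏ₘ q) ⟶ₘ q,
    p ⟶ₘ (q ⟶ₘ (p ⋏ₘ q)),
    p ⟶ₘ (p ⋎ₘ q),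
    p ⟶ₘ (q ⋎ₘ p),
    (p ⟶ₘ r) ⟶ₘ ((q ⟶ₘ r) ⟶ₘ ((p ⋎ₘ q) ⟶ₘ r)),
    (p ⟶ₘ q) ⟶ₘ ((p ⟶ₘ ∼ₘ q) ⟶ₘ ∼ₘ p),
    p ⟶ₘ (∼ₘ p ⟶ₘ q) }

/-- The modal axioms of `E`. -/
def modalAxioms : Set Formula :=
  { □ₘ (p ⟶ₘ q) ⟶ₘ (□ₘ p ⟶ₘ □ₘ q),
    p ⟶ₘ □ₘ p,
    □ₘ p ⟶ₘ (((q ⟶ₘ p) ⟶ₘ q) ⟶ₘ q) }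

/-- Derivability from a set of axioms by modus ponens and uniform substitution. -/
inductive Derivable (Ax : Set Formula) : Formula → Prop
  | ax {α : Formula} : α ∈ Ax → Derivable Ax α
  | mp {α β : Formula} : Derivable Ax (α ⟶ₘ β) → Derivable Ax α → Derivable Ax β
  | subst {α : Formula} (s : ℕ → Formula) : Derivable Ax α → Derivable Ax (α.subst s)

/-- The modalized Heyting calculus `E`, as its set of derivable formulas. -/
def E : Set Formula := {α | Derivable (intAxioms ∪ modalAxioms) α}

/-- `L` is a normal extension of `L₀`: a set of formulas that includes `L₀` and is closed under
modus ponens, uniform substitution and necessitation. -/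
structure IsNormalExtension (L₀ L : Set Formula) : Prop where
  subset : L₀ ⊆ L
  mp : ∀ α β : Formula, (α ⟶ₘ β) ∈ L → α ∈ L → β ∈ L
  subst : ∀ (s : ℕ → Formula) (α : Formula), α ∈ L → α.subst s ∈ L
  nec : ∀ α : Formula, α ∈ L → □ₘ α ∈ L

/-- `L` is closed under the weakening rule: from `□α` infer `α`. -/
def ClosedUnderWeakening (L : Set Formula) : Prop :=
  ∀ α : Formula, □ₘ α ∈ L → α ∈ L

end ModalHeyting

namespace ModalHeyting

/-! ### Kripke semantics over partial orders with irreflexive points -/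

section Semantics

variable {W : Type*} [PartialOrder W]

/-! The upper bound holds because formulas are countable. For the lower bound, each set `S` of spur
indices gives a rooted poset whose chain is irreflexive and whose spurs are reflexive exactly at
indices in `S`. Every such frame validates `E`, and its reflexive root yields closure under
weakening. The iterates `boxBot k` measure height along the chain, so `noSpur n` can detect whether
spur `n + 1` is reflexive (`noSpur_mem_validFormulas_iff`). Distinct sets of positive indices thus
give distinct logics. -/

/-- The modal accessibility relation of a poset whose set of irreflexive points is `I`. -/
def Access (I : Set W) (x y : W) : Prop := x ≤ y ∧ (x ∈ I → x ≠ y)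

/-- Truth of a formula at a point of a poset with irreflexive points `I`. -/
def Forces (I : Set W) (V : ℕ → UpperSet W) : Formula → W → Prop
  | .var n, x => x ∈ V n
  | .and α β, x => Forces I V α x ∧ Forces I V β x
  | .or α β, x => Forces I V α x ∨ Forces I V β x
  | .imp α β, x => ∀ y, x ≤ y → Forces I V α y → Forces I V β y
  | .neg α, x => ∀ y, x ≤ y → ¬ Forces I V α y
  | .box α, x => ∀ y, Access I x y → Forces I V α y

theorem Access.of_le {I : Set W} {x y z : W} (hxy : x ≤ y) (h : Access I y z) : Access I x z := by
  refine ⟨hxy.trans h.1, ?_⟩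
  rintro hx rfl
  obtain rfl := le_antisymm hxy h.1
  exact h.2 hx rfl

theorem Forces.mono {I : Set W} {V : ℕ → UpperSet W} {α : Formula} {x y : W} (hxy : x ≤ y)
    (h : Forces I V α x) : Forces I V α y := by
  induction α with
  | var n => exact (V n).upper hxy h
  | and α β ihα ihβ => exact ⟨ihα h.1, ihβ h.2⟩
  | or α β ihα ihβ => exact h.imp ihα ihβ
  | imp α β => exact fun z hz => h z (hxy.trans hz)
  | neg α => exact fun z hz => h z (hxy.trans hz)
  | box α => exact fun z hz => h z (hz.of_le hxy)

/-- The set of points at which a formula is true, as an upper set. -/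
def truthSet (I : Set W) (V : ℕ → UpperSet W) (α : Formula) : UpperSet W where
  carrier := {x | Forces I V α x}
  upper' _ _ hxy h := Forces.mono hxy h

theorem forces_subst (I : Set W) (V : ℕ → UpperSet W) (s : ℕ → Formula) (α : Formula) (x : W) :
    Forces I V (α.subst s) x ↔ Forces I (fun n => truthSet I V (s n)) α x := by
  induction α generalizing x with
  | var n => rfl
  | and α β ihα ihβ => simp only [Formula.subst, Forces, ihα, ihβ]
  | or α β ihα ihβ => simp only [Formula.subst, Forces, ihα, ihβ]
  | imp α β ihα ihβ => simp only [Formula.subst, Forces, ihα, ihβ]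
  | neg α ihα => simp only [Formula.subst, Forces, ihα]
  | box α ihα => simp only [Formula.subst, Forces, ihα]

/-- The formulas valid on a poset with irreflexive points `I`. -/
def validFormulas (I : Set W) : Set Formula := {α | ∀ V x, Forces I V α x}

theorem intAxioms_subset_validFormulas (I : Set W) : intAxioms ⊆ validFormulas I := by
  intro α hα V x
  rcases hα with rfl | rfl | rfl | rfl | rfl | rfl | rfl | rfl | rfl | rfl
  · exact fun y _ hp z hyz _ => hp.mono hyz
  · exact fun y _ h z hyz h' u hzu hp =>
      h u (hyz.trans hzu) hp u le_rfl (h' u hzu hp)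
  · exact fun y _ h => h.1
  · exact fun y _ h => h.2
  · exact fun y _ hp z hyz hq => ⟨hp.mono hyz, hq⟩
  · exact fun y _ hp => Or.inl hp
  · exact fun y _ hp => Or.inr hp
  · exact fun y _ h z hyz h' u hzu hpq =>
      hpq.elim (h u (hyz.trans hzu)) (h' u hzu)
  · exact fun y _ h z hyz h' u hzu hp =>
      h' u hzu hp u le_rfl (h u (hyz.trans hzu) hp)
  · exact fun y _ hp z hyz hn => (hn z le_rfl (hp.mono hyz)).elim

theorem modalAxioms_subset_validFormulas (I : Set W) : modalAxioms ⊆ validFormulas I := by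
  intro α hα V x
  rcases hα with rfl | rfl | rfl
  · exact fun y _ h z hyz hp u hzu => h u (hzu.of_le hyz) u le_rfl (hp u hzu)
  · exact fun y _ hp z hyz => hp.mono hyz.1
  · intro y _ h z hyz hq
    by_contra hnq
    -- A point `u` above `z` forcing `q` cannot be `z`, so it lies strictly above `y` and is
    -- accessible from it.
    refine hnq (hq z le_rfl fun u hzu hqu => h u ⟨hyz.trans hzu, ?_⟩)
    rintro - rfl
    obtain rfl := le_antisymm hyz hzu
    exact hnq hqu

theorem isNormalExtension_validFormulas (I : Set W) : IsNormalExtension E (validFormulas I) := by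
  have mp : ∀ α β : Formula, (α ⟶ₘ β) ∈ validFormulas I → α ∈ validFormulas I →
      β ∈ validFormulas I := fun α β h hα V x => h V x x le_rfl (hα V x)
  have subst : ∀ (s : ℕ → Formula) (α : Formula), α ∈ validFormulas I →
      α.subst s ∈ validFormulas I := fun s α h V x => (forces_subst I V s α x).2 (h _ x)
  refine ⟨fun α hα => ?_, mp, subst, fun α h V x y _ => h V y⟩
  change Derivable _ α at hα
  induction hα with
  | ax h =>
    exact h.elim (fun h => intAxioms_subset_validFormulas I h)
      fun h => modalAxioms_subset_validFormulas I h
  | mp _ _ ih ih' => exact mp _ _ ih ih'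
  | subst s _ ih => exact subst s _ ih

/-- A reflexive bottom accesses itself, so `□α` there gives `α` there, and persistence carries `α`
everywhere. -/
theorem closedUnderWeakening_validFormulas [OrderBot W] {I : Set W} (h : ⊥ ∉ I) :
    ClosedUnderWeakening (validFormulas I) := fun _ hα V _ =>
  (hα V ⊥ ⊥ ⟨le_rfl, fun h' => (h h').elim⟩).mono bot_le

end Semantics

/-! ### A rooted poset with a descending chain and a spur attached to each level of the chain -/

/-- The points of the spurred chain. -/
inductive SpurredChain : Type
  | root : SpurredChain
  | chain : ℕ → SpurredChain
  | spur : ℕ → SpurredChain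

namespace SpurredChain

/-- The root lies below everything, `chain i` decreases with `i`, and the points strictly above
`spur n` are the `chain i` with `i < n`. -/
def Below : SpurredChain → SpurredChain → Prop
  | root, _ => True
  | chain i, chain j => j ≤ i
  | spur n, chain i => i < n
  | spur n, spur m => n = m
  | _, _ => False

instance : PartialOrder SpurredChain where
  le := Below
  le_refl x := by cases x <;> simp [Below]
  le_trans x y z := by
    cases x <;> cases y <;> cases z <;> simp only [Below] <;> lia
  le_antisymm x y := by
    cases x <;> cases y <;> simp [Below] <;> lia

instance : OrderBot SpurredChain where
  bot := root
  bot_le _ := trivial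

theorem chain_le_chain {i j : ℕ} : chain i ≤ chain j ↔ j ≤ i := Iff.rfl

theorem spur_le_chain {n i : ℕ} : spur n ≤ chain i ↔ i < n := Iff.rfl

theorem not_chain_le_spur {i n : ℕ} : ¬ chain i ≤ spur n := id

theorem not_chain_le_root {i : ℕ} : ¬ chain i ≤ root := id

theorem not_spur_le_root {n : ℕ} : ¬ spur n ≤ root := id

theorem root_le (x : SpurredChain) : root ≤ x := trivial

/-- The irreflexive points: the chain, and the spurs whose index is outside `S`. -/
def irreflexive (S : Set ℕ) : Set SpurredChain :=
  {x | match x with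
    | root => False
    | chain _ => True
    | spur n => n ∉ S}

/-- The points that satisfy `k` iterations of the modality on falsum. -/
def Depth (S : Set ℕ) (k : ℕ) : SpurredChain → Prop
  | root => False
  | chain i => i < k
  | spur n => n ∉ S ∧ n < k

end SpurredChain

open SpurredChain

/-! ### Formulas that detect reflexive spurs -/

/-- The modality applied `k` times to a contradiction. -/
def boxBot : ℕ → Formula
  | 0 => p ⋏ₘ ∼ₘ p
  | k + 1 => □ₘ (boxBot k)

/-- A formula expressing that no reflexive spur has index `n + 1`. -/
def noSpur (n : ℕ) : Formula :=
  (boxBot (n + 2) ⟶ₘ boxBot (n + 1)) ⟶ₘ (boxBot (n + 1) ⋎ₘ (boxBot (n + 1) ⟶ₘ boxBot n))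

/-- A reflexive point accesses itself, so it forces no iterate. An irreflexive point of index `i`
accesses exactly the `chain j` with `j < i`. -/
theorem forces_boxBot (S : Set ℕ) (V : ℕ → UpperSet SpurredChain) (k : ℕ) (x : SpurredChain) :
    Forces (irreflexive S) V (boxBot k) x ↔ Depth S k x := by
  induction k generalizing x with
  | zero =>
    have h : ¬ Forces (irreflexive S) V (boxBot 0) x := fun h => h.2 x le_rfl h.1
    cases x <;> simp [h, Depth]
  | succ k ih =>
    change (∀ y, Access (irreflexive S) x y → _) ↔ _
    simp only [ih]
    cases x with
    | root => exact ⟨fun h => h root ⟨le_rfl, fun h' => h'.elim⟩, False.elim⟩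
    | chain i =>
      constructor
      · intro h
        by_contra hi
        change ¬ i < k + 1 at hi
        have : k < k := h (chain k) ⟨chain_le_chain.2 (by lia), fun _ e => by
          cases e; lia⟩
        lia
      · rintro (h : i < k + 1) (_ | j | m) ⟨hle, hne⟩
        · exact (not_chain_le_root hle).elim
        · have h₁ : j ≤ i := hle
          have h₂ : i ≠ j := fun e => hne trivial (e ▸ rfl)
          change j < k
          lia
        · exact (not_chain_le_spur hle).elim
    | spur n =>
      constructor
      · intro h
        refine ⟨fun hn => (h (spur n) ⟨le_rfl, fun h' => (h' hn).elim⟩).1 hn, ?_⟩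
        by_contra hn
        have : k < k := h (chain k) ⟨spur_le_chain.2 (by lia), fun _ e => nomatch e⟩
        lia
      · rintro ⟨hS, hn⟩ (_ | j | m) ⟨hle, hne⟩
        · exact (not_spur_le_root hle).elim
        · have : j < n := hle
          change j < k
          lia
        · obtain rfl : n = m := hle
          exact (hne hS rfl).elim

/-- The premise of `noSpur n` excludes irreflexive points of index `n + 1` above. A reflexive `spur
(n + 1)` meets it, yet has no finite depth and sees `chain n`, so both disjuncts fail. Any other
point either sees an irreflexive point of index `n + 1` or satisfies a disjunct. -/
theorem noSpur_mem_validFormulas_iff (S : Set ℕ) (n : ℕ) :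
    noSpur n ∈ validFormulas (irreflexive S) ↔ n + 1 ∉ S := by
  have key : ∀ V x, Forces (irreflexive S) V (noSpur n) x ↔
      ∀ y, x ≤ y → (∀ z, y ≤ z → Depth S (n + 2) z → Depth S (n + 1) z) →
        (Depth S (n + 1) y ∨ ∀ z, y ≤ z → Depth S (n + 1) z → Depth S n z) := by
    intro V x
    simp only [noSpur, Forces, forces_boxBot]
  constructor
  · intro h hS
    have hspur : ∀ z, spur (n + 1) ≤ z → Depth S (n + 2) z → Depth S (n + 1) z := by
      rintro (_ | j | m) hle hd
      · exact hd.elim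
      · exact spur_le_chain.1 hle
      · obtain rfl : n + 1 = m := hle
        exact (hd.1 hS).elim
    rcases (key (fun _ => ⊤) (spur (n + 1))).1 (h _ _) _ le_rfl hspur with h | h
    · exact h.1 hS
    · have : n < n := h (chain n) (spur_le_chain.2 (by lia)) (Nat.lt_succ_self n)
      lia
  · intro hS V x
    refine (key V x).2 fun y _ h => ?_
    cases y with
    | root =>
      have : n + 1 < n + 1 := h (chain (n + 1)) (root_le _) (Nat.lt_succ_self _)
      lia
    | chain i =>
      left
      by_contra hi
      change ¬ i < n + 1 at hi
      have : n + 1 < n + 1 := h (chain (n + 1)) (chain_le_chain.2 (by lia)) (Nat.lt_succ_self _)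
      lia
    | spur m =>
      have hm : ¬ n + 1 < m := fun hm =>
        absurd (h (chain (n + 1)) hm (Nat.lt_succ_self _)) (lt_irrefl (n + 1))
      have hm' : m ≠ n + 1 := by
        rintro rfl
        exact absurd (h (spur (n + 1)) le_rfl ⟨hS, Nat.lt_succ_self _⟩).2 (lt_irrefl _)
      by_cases hmS : m ∈ S
      · right
        rintro (_ | j | l) hle hd
        · exact hd.elim
        · have : j < m := hle
          change j < n
          lia
        · obtain rfl : m = l := hle
          exact (hd.1 hmS).elim
      · exact Or.inl ⟨hmS, by lia⟩

/-! ### Counting the extensions -/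

/-- An injective coding of formulas by lists of natural numbers, in prefix notation. -/
def Formula.code : Formula → List ℕ
  | .var n => [0, n]
  | .and α β => 1 :: (α.code ++ β.code)
  | .or α β => 2 :: (α.code ++ β.code)
  | .imp α β => 3 :: (α.code ++ β.code)
  | .neg α => 4 :: α.code
  | .box α => 5 :: α.code

/-- The arbitrary tails let the induction split the concatenated codes of a binary connective. -/
theorem Formula.eq_of_code_append_eq {α β : Formula} {l l' : List ℕ}
    (h : α.code ++ l = β.code ++ l') : α = β ∧ l = l' := by
  induction α generalizing β l l' with
  | var n => cases β <;> simp_all [Formula.code]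
  | and α₁ α₂ ih₁ ih₂ | or α₁ α₂ ih₁ ih₂ | imp α₁ α₂ ih₁ ih₂ =>
    cases β <;> simp [Formula.code] at h
    obtain ⟨rfl, h₂⟩ := ih₁ h
    obtain ⟨rfl, rfl⟩ := ih₂ h₂
    exact ⟨rfl, rfl⟩
  | neg α ih | box α ih =>
    cases β <;> simp [Formula.code] at h
    obtain ⟨rfl, rfl⟩ := ih h
    exact ⟨rfl, rfl⟩

instance : Countable Formula :=
  Function.Injective.countable (f := Formula.code) fun _ _ h =>
    (Formula.eq_of_code_append_eq (congrArg (· ++ []) h)).1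

theorem mk_set_formula_le : Cardinal.mk (Set Formula) ≤ Cardinal.continuum := by
  rw [Cardinal.mk_set, ← Cardinal.two_power_aleph0]
  exact Cardinal.power_le_power_left two_ne_zero Cardinal.mk_le_aleph0

end ModalHeyting

open ModalHeyting in
theorem continuum_le_mk_normalExtensions :
    Cardinal.continuum ≤ Cardinal.mk {L : Set Formula //
      IsNormalExtension E L ∧ ClosedUnderWeakening L} := by
  have h := Cardinal.mk_le_of_injective (α := Set ℕ)
    (β := {L : Set Formula // IsNormalExtension E L ∧ ClosedUnderWeakening L})
    -- The shift by `Nat.succ` is needed because `noSpur` tests only positive indices; `id` works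
    -- because membership of the root in the irreflexive points unfolds to `False`.
    (f := fun S => ⟨validFormulas (SpurredChain.irreflexive (Nat.succ '' S)),
      isNormalExtension_validFormulas _, closedUnderWeakening_validFormulas id⟩) ?_
  · simpa [Cardinal.mk_set] using h
  · intro S T hST
    have hL := congrArg Subtype.val hST
    ext n
    have := noSpur_mem_validFormulas_iff (Nat.succ '' S) n
    rw [show validFormulas (SpurredChain.irreflexive (Nat.succ '' S)) =
      validFormulas (SpurredChain.irreflexive (Nat.succ '' T)) from hL,
      noSpur_mem_validFormulas_iff] at this
    simpa using (not_congr this).symm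

theorem propositionP :
    Cardinal.mk {L : Set ModalHeyting.Formula //
        ModalHeyting.IsNormalExtension ModalHeyting.E L ∧ ModalHeyting.ClosedUnderWeakening L} =
      Cardinal.continuum :=
  le_antisymm ((Cardinal.mk_subtype_le _).trans ModalHeyting.mk_set_formula_le)
    continuum_le_mk_normalExtensions
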